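/- Let $m\ge 2$ be an integer, let $\sigma\in[\tfrac54,2]$, and put $\beta:=2\pi m\bigl(1-\tfrac1{2\sigma}\bigr)$. Call a positive even integer $N$ admissible if $N_1:=\sigma N$ is also an even integer, and assume that there is an admissible $N$. For admissible $N$ let $$\varphi(x):=\begin{cases}\dfrac{1}{I_2(\beta)}\Bigl(1-\dfrac{(N_1x)^2}{m^2}\Bigr)I_2\Bigl(\beta\sqrt{1-\tfrac{(N_1x)^2}{m^2}}\Bigr), & |x|\le \tfrac{m}{N_1},\\ 0, & |x|>\tfrac m{N_1},\end{cases}$$ be the Bessel window function, where $I_2$ is the modified Bessel function of the first kind of order $2$, and let $\hat\varphi(v):=\int_{\mathbb R}\varphi(t)\,e^{-2\pi i vt}\,dt$. Then for every admissible $N$ the following holds. The function $\varphi:\mathbb R\to[0,1]$ is even and continuous, has support $[-\tfrac m{N_1},\tfrac m{N_1}]$, is decreasing on $[0,\tfrac m{N_1}]$ with $\varphi(0)=1$ and $\varphi(\tfrac m{N_1})=0$, and $\hat\varphi$ is positive on $[-\tfrac N2,\tfrac N2]$. For every $n\in I_N:=\{-\tfrac N2,1-\tfrac N2,\dots,\tfrac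 N2-1\}$ the series $\sum_{r\in\mathbb Z\setminus\{0\}}\frac{\hat\varphi(n+rN_1)}{\hat\varphi(n)}\,e^{2\pi i rN_1\,\cdot}$ converges unconditionally in the Banach space $C(\mathbb T)$ of continuous $1$-periodic functions with the uniform norm. Moreover, the $C(\mathbb T)$-error constant $$e_\sigma(\varphi):=\sup_{N\text{ admissible}}\ \max_{n\in I_N}\Bigl\|\sum_{r\in\mathbb Z\setminus\{0\}}\frac{\hat\varphi(n+rN_1)}{\hat\varphi(n)}\,e^{2\pi i rN_1\,\cdot}\Bigr\|_{C(\mathbb T)}$$ satisfies $$e_\sigma(\varphi)\le (50m^3+7)\,e^{-2\pi m\sqrt{1-1/\sigma}}.$$ -/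

import Mathlib

open scoped FourierTransform ENNReal

noncomputable section

/-- The modified Bessel function of the first kind of integer order `n`,
`I_n(x) = ∑_{k ≥ 0} (x/2)^(2k+n) / (k! (k+n)!)`. -/
def besselI (n : ℕ) (x : ℝ) : ℝ :=
  ∑' k : ℕ, (x / 2) ^ (2 * k + n) / ((k.factorial : ℝ) * ((k + n).factorial : ℝ))

/-- The Fourier transform `φ̂(v) = ∫ φ(t) e^{-2πivt} dt` of a real-valued function on `ℝ`. -/
def windowFT (φ : ℝ → ℝ) (v : ℝ) : ℂ :=
  𝓕 (fun t : ℝ => (φ t : ℂ)) v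

/-- `φ` belongs to the set `Φ_{m,N₁}` of window functions; `N` is the bandwidth in the condition that
`φ̂` is (real and) positive on `[-N/2, N/2]`. -/
structure IsWindow (m N N₁ : ℕ) (φ : ℝ → ℝ) : Prop where
  mem_Icc : ∀ x, φ x ∈ Set.Icc (0 : ℝ) 1
  even : ∀ x, φ (-x) = φ x
  tsupport_eq : tsupport φ = Set.Icc (-((m : ℝ) / N₁)) ((m : ℝ) / N₁)
  continuous : Continuous φ
  antitoneOn : AntitoneOn φ (Set.Icc 0 ((m : ℝ) / N₁))
  map_zero : φ 0 = 1
  map_end : φ ((m : ℝ) / N₁) = 0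
  ft_pos : ∀ v ∈ Set.Icc (-((N : ℝ) / 2)) ((N : ℝ) / 2),
    0 < (windowFT φ v).re ∧ (windowFT φ v).im = 0

/-- The index set `I_N = {-N/2, 1 - N/2, …, N/2 - 1}` for even `N`. -/
def freqIndex (N : ℕ) : Finset ℤ :=
  Finset.Ico (-((N : ℤ) / 2)) ((N : ℤ) / 2)

/-- The pair `(N, N₁)` is admissible for the oversampling factor `σ`:
`N` and `N₁ = σ N` are both positive even integers. -/
def IsAdmissible (σ : ℝ) (N N₁ : ℕ) : Prop :=
  0 < N ∧ Even N ∧ 0 < N₁ ∧ Even N₁ ∧ (N₁ : ℝ) = σ * N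

/-- The `r`-th aliasing term `(φ̂(n + r N₁) / φ̂(n)) e^{2πi r N₁ ·}`, as an element of `C(𝕋)`. -/
def aliasTerm (N₁ : ℕ) (φ : ℝ → ℝ) (n r : ℤ) : C(UnitAddCircle, ℂ) :=
  (windowFT φ ((n : ℝ) + (r : ℝ) * (N₁ : ℝ)) / windowFT φ (n : ℝ)) •
    (fourier (r * (N₁ : ℤ)) : C(UnitAddCircle, ℂ))

/-- The constant `e_{σ,N}(φ)`: the maximum over `n ∈ I_N` of the uniform norm of the sum, over all
integers `r ≠ 0`, of the aliasing terms. -/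
def errorConstAt (N N₁ : ℕ) (φ : ℝ → ℝ) : ℝ≥0∞ :=
  ⨆ n ∈ freqIndex N, ‖∑' r : {r : ℤ // r ≠ 0}, aliasTerm N₁ φ n (r : ℤ)‖ₑ

/-- The `C(𝕋)`-error constant `e_σ(φ) = sup_N e_{σ,N}(φ)` of a window function depending on `N₁`,
the supremum being over all positive even `N` for which `N₁ = σ N` is an even integer. -/
def errorConst (σ : ℝ) (φ : ℕ → ℝ → ℝ) : ℝ≥0∞ :=
  ⨆ (N : ℕ) (N₁ : ℕ) (_ : IsAdmissible σ N N₁), errorConstAt N N₁ (φ N₁)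

/-- The shape parameter `β = 2πm(1 - 1/(2σ))`. -/
def shapeParam (m : ℕ) (σ : ℝ) : ℝ :=
  2 * Real.pi * m * (1 - 1 / (2 * σ))

open Classical in
/-- The Bessel window function with shape parameter `β`. -/
def besselWindow (m : ℕ) (β : ℝ) (N₁ : ℕ) (x : ℝ) : ℝ :=
  if x ∈ Set.Icc (-((m : ℝ) / N₁)) ((m : ℝ) / N₁) then
    1 / besselI 2 β * (1 - ((N₁ : ℝ) * x) ^ 2 / (m : ℝ) ^ 2) *
      besselI 2 (β * √(1 - ((N₁ : ℝ) * x) ^ 2 / (m : ℝ) ^ 2))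
  else 0

end

/-! Up to scaling, `φ̂` is the cosine transform on `[-1, 1]` of `(1 - s²) I_2(β√(1 - s²))`.
Expanding both factors and grouping terms of total degree `n`, the binomial theorem produces `(β² -
w²)^n`; hence (`integral_besselProfile_mul_cos`) the transform is `β²/8` times the transform of `(1
- s²)²` against `cosh` or `cos` with argument `s√|β² - w²|`. These are elementary integrals.

With `w = 2πmν`, `ν = n/N₁` and `|ν| ≤ 1/(2σ)`, the choice of `β` gives `β² - w² ≥ x₀²`, where `x₀ =
2πm√(1 - 1/σ)`. The `cosh` regime then bounds the denominator below by a multiple of `e^{x₀}/x₀³`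
(`le_besselCosTransform`). Shifting `ν` by `r ≠ 0` lands in the `cos` regime, with `w² - β² ≥
(2πm(|r| - 1))²`: a trivial bound for `|r| = 1` and cubic decay beyond it. The prefactors cancel in
the quotient (`abs_besselCosTransform_div_le`). Summing over `r` gives `50m³ + 2π²/3 ≤ 50m³ + 7`,
and absolute convergence in norm yields unconditional convergence. -/

/-! ### Moments and the power series of the profile -/

/-- The moment `∫_{-1}^1 (1 - s²)^k s^(2j) ds`. -/
noncomputable def quadMoment (k j : ℕ) : ℝ :=
  ∫ s in (-1 : ℝ)..1, (1 - s ^ 2) ^ k * s ^ (2 * j)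

/-- The `k`-th coefficient of `I_2(β)` as a series. -/
noncomputable def besselCoeff (β : ℝ) (k : ℕ) : ℝ :=
  (β / 2) ^ (2 * k + 2) / ((k.factorial : ℝ) * ((k + 2).factorial : ℝ))

/-- `u I_2(β √u)`, as a power series in `u`. -/
noncomputable def besselProfile (β u : ℝ) : ℝ :=
  ∑' k : ℕ, besselCoeff β k * u ^ (k + 2)

/-- Integration by parts: `(1 - s²)^(k+1) s^(2j+1)` vanishes at `±1`. -/
lemma quadMoment_succ_left (k j : ℕ) :
    (2 * j + 1) * quadMoment (k + 1) j = 2 * (k + 1) * quadMoment k (j + 1) := by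
  have h : ∫ s in (-1 : ℝ)..1, ((2 * j + 1) * ((1 - s ^ 2) ^ (k + 1) * s ^ (2 * j)) -
      2 * (k + 1) * ((1 - s ^ 2) ^ k * s ^ (2 * (j + 1)))) =
      (1 - (1 : ℝ) ^ 2) ^ (k + 1) * 1 ^ (2 * j + 1) -
        (1 - (-1 : ℝ) ^ 2) ^ (k + 1) * (-1) ^ (2 * j + 1) := by
    refine intervalIntegral.integral_eq_sub_of_hasDerivAt
      (f := fun s : ℝ => (1 - s ^ 2) ^ (k + 1) * s ^ (2 * j + 1)) (fun s _ => ?_) ?_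
    · have h1 : HasDerivAt (fun s : ℝ => 1 - s ^ 2) (-(2 * s)) s := by
        simpa using (hasDerivAt_pow 2 s).const_sub 1
      refine ((h1.pow (k + 1)).mul (hasDerivAt_pow (2 * j + 1) s)).congr_deriv ?_
      simp only [Nat.add_sub_cancel, Nat.cast_add, Nat.cast_mul, Nat.cast_one, Nat.cast_ofNat,
        Pi.pow_apply]
      ring
    · exact Continuous.intervalIntegrable (by fun_prop) _ _
  rw [intervalIntegral.integral_sub (Continuous.intervalIntegrable (by fun_prop) _ _)
    (Continuous.intervalIntegrable (by fun_prop) _ _), intervalIntegral.integral_const_mul,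
    intervalIntegral.integral_const_mul] at h
  simp only [quadMoment]
  norm_num at h
  linarith

lemma quadMoment_eq (k j : ℕ) :
    quadMoment k j = ((2 * j).factorial * k.factorial : ℝ) /
      (4 ^ j * j.factorial * (k + j).factorial) * quadMoment (k + j) 0 := by
  induction j generalizing k with
  | zero =>
    have : (k.factorial : ℝ) ≠ 0 := by positivity
    simp [this]
  | succ j ih =>
    have h := quadMoment_succ_left k j
    have h2 : quadMoment k (j + 1) =
        (2 * j + 1) / (2 * (k + 1)) * quadMoment (k + 1) j := by
      field_simp
      linarith
    rw [h2, ih (k + 1), show k + 1 + j = k + (j + 1) by ring,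
      show 2 * (j + 1) = 2 * j + 1 + 1 by ring]
    simp only [Nat.factorial_succ, Nat.cast_mul, Nat.cast_add, Nat.cast_one, Nat.cast_ofNat]
    have e1 : ((k + (j + 1)).factorial : ℝ) ≠ 0 := by positivity
    rw [pow_succ]
    field_simp
    ring

lemma besselCoeff_nonneg (β : ℝ) (k : ℕ) : 0 ≤ besselCoeff β k := by
  unfold besselCoeff
  rw [show 2 * k + 2 = 2 * (k + 1) by ring, pow_mul]
  positivity

lemma besselCoeff_pos {β : ℝ} (hβ : 0 < β) (k : ℕ) : 0 < besselCoeff β k := by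
  unfold besselCoeff
  positivity

lemma summable_besselCoeff (β : ℝ) : Summable (besselCoeff β) := by
  refine Summable.of_nonneg_of_le (besselCoeff_nonneg β) (fun k => ?_)
    ((Real.summable_pow_div_factorial ((β / 2) ^ 2)).mul_left ((β / 2) ^ 2))
  unfold besselCoeff
  have h1 : (1 : ℝ) ≤ (k + 2).factorial := by exact_mod_cast Nat.factorial_pos _
  have h2 : (0 : ℝ) < k.factorial := by positivity
  calc (β / 2) ^ (2 * k + 2) / ((k.factorial : ℝ) * ((k + 2).factorial : ℝ))
      ≤ (β / 2) ^ (2 * k + 2) / (k.factorial : ℝ) := by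
        apply div_le_div_of_nonneg_left _ h2 (le_mul_of_one_le_right h2.le h1)
        rw [show 2 * k + 2 = 2 * (k + 1) by ring, pow_mul]
        positivity
    _ = _ := by rw [pow_add, pow_mul]; ring

lemma summable_besselProfile (β : ℝ) {u : ℝ} (h0 : 0 ≤ u) (h1 : u ≤ 1) :
    Summable fun k => besselCoeff β k * u ^ (k + 2) :=
  Summable.of_nonneg_of_le (fun k => mul_nonneg (besselCoeff_nonneg β k) (by positivity))
    (fun k => mul_le_of_le_one_right (besselCoeff_nonneg β k) (pow_le_one₀ h0 h1))
    (summable_besselCoeff β)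

lemma besselProfile_eq (β : ℝ) {u : ℝ} (h0 : 0 ≤ u) :
    besselProfile β u = u * besselI 2 (β * √u) := by
  unfold besselProfile besselI
  rw [← tsum_mul_left]
  refine tsum_congr fun k => ?_
  unfold besselCoeff
  rw [show β * √u / 2 = β / 2 * √u by ring, mul_pow _ (√u), show 2 * k + 2 = 2 * (k + 1) by ring,
    pow_mul (√u), Real.sq_sqrt h0]
  ring

lemma besselProfile_one (β : ℝ) : besselProfile β 1 = besselI 2 β := by
  rw [besselProfile_eq β zero_le_one]
  simp

lemma besselProfile_zero (β : ℝ) : besselProfile β 0 = 0 := by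
  simp [besselProfile]

lemma besselProfile_mono (β : ℝ) {u v : ℝ} (h0 : 0 ≤ u) (huv : u ≤ v) (h1 : v ≤ 1) :
    besselProfile β u ≤ besselProfile β v := by
  refine Summable.tsum_le_tsum (fun k => ?_) (summable_besselProfile β h0 (huv.trans h1))
    (summable_besselProfile β (h0.trans huv) h1)
  have := besselCoeff_nonneg β k
  gcongr

lemma besselProfile_pos {β u : ℝ} (hβ : 0 < β) (h0 : 0 < u) (h1 : u ≤ 1) :
    0 < besselProfile β u :=
  (summable_besselProfile β h0.le h1).tsum_pos
    (fun k => mul_nonneg (besselCoeff_nonneg β k) (by positivity)) 0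
    (mul_pos (besselCoeff_pos hβ 0) (by positivity))

/-! ### Termwise integration and the cosine transform -/

lemma Real.hasSum_mul_prod {f g : ℕ → ℝ} {a b : ℝ} (hf : HasSum f a) (hg : HasSum g b) :
    HasSum (fun p : ℕ × ℕ => f p.1 * g p.2) (a * b) :=
  hf.mul hg (summable_mul_of_summable_norm hf.summable.norm hg.summable.norm)

lemma Real.hasSum_integral_of_abs_le {ι : Type*} [Countable ι] {F : ι → ℝ → ℝ} {f : ℝ → ℝ}
    {C : ι → ℝ} {a b : ℝ} (hab : a ≤ b) (hF : ∀ i, Continuous (F i))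
    (hb : ∀ i, ∀ s, a ≤ s → s ≤ b → |F i s| ≤ C i)
    (hC : Summable C) (hs : ∀ s, a ≤ s → s ≤ b → HasSum (fun i => F i s) (f s)) :
    HasSum (fun i => ∫ s in a..b, F i s) (∫ s in a..b, f s) := by
  refine intervalIntegral.hasSum_integral_of_dominated_convergence (fun i _ => C i)
    (fun i => (hF i).aestronglyMeasurable) (fun i => ?_) ?_ (by simp) ?_
  all_goals
    refine Filter.Eventually.of_forall fun s h => ?_
    rw [Set.uIoc_of_le hab] at h
  · exact hb i s h.1.le h.2
  · exact hC
  · exact hs s h.1.le h.2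

lemma hasSum_cos_integral (β w : ℝ) :
    HasSum (fun p : ℕ × ℕ => besselCoeff β p.1 * ((-1) ^ p.2 * w ^ (2 * p.2) /
        (2 * p.2).factorial) * quadMoment (p.1 + 2) p.2)
      (∫ s in (-1 : ℝ)..1, besselProfile β (1 - s ^ 2) * Real.cos (w * s)) := by
  have hsum : Summable fun p : ℕ × ℕ => besselCoeff β p.1 * (w ^ (2 * p.2) /
      (2 * p.2).factorial) :=
    (summable_besselCoeff β).mul_of_nonneg (Real.hasSum_cosh w).summable
      (fun k => besselCoeff_nonneg β k)
      (fun k => by simp only [Pi.zero_apply, pow_mul]; positivity)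
  have hF (p : ℕ × ℕ) : besselCoeff β p.1 * ((-1) ^ p.2 * w ^ (2 * p.2) /
        (2 * p.2).factorial) * quadMoment (p.1 + 2) p.2 =
      ∫ s in (-1 : ℝ)..1, besselCoeff β p.1 * (1 - s ^ 2) ^ (p.1 + 2) *
        ((-1) ^ p.2 * (w * s) ^ (2 * p.2) / (2 * p.2).factorial) := by
    rw [quadMoment, ← intervalIntegral.integral_const_mul]
    refine intervalIntegral.integral_congr fun s _ => ?_
    simp only [mul_pow]
    ring
  simp only [hF]
  refine Real.hasSum_integral_of_abs_le (by norm_num) (fun p => by fun_prop)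
    (fun p s h1 h2 => ?_) hsum (fun s h1 h2 => ?_)
  all_goals
    have hs2 : s ^ 2 ≤ 1 := by nlinarith
    have hs0 := sq_nonneg s
  · have h1 : (1 - s ^ 2) ^ (p.1 + 2) ≤ 1 := pow_le_one₀ (by linarith) (by linarith)
    have h0 : 0 ≤ (1 - s ^ 2) ^ (p.1 + 2) := pow_nonneg (by linarith) _
    have hb := besselCoeff_nonneg β p.1
    have hw : (0 : ℝ) ≤ w ^ (2 * p.2) := by rw [pow_mul]; positivity
    have hsj : |s ^ (2 * p.2)| ≤ 1 := by
      rw [pow_mul, abs_of_nonneg (by positivity)]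
      exact pow_le_one₀ hs0 hs2
    rw [abs_mul, abs_mul, abs_div, abs_mul, mul_pow, abs_mul, abs_of_nonneg hb,
      abs_of_nonneg h0, abs_of_nonneg hw, Nat.abs_cast, abs_pow, abs_neg, abs_one, one_pow, one_mul]
    refine mul_le_mul (mul_le_of_le_one_right hb h1) ?_ (by positivity) hb
    gcongr
    exact mul_le_of_le_one_right hw hsj
  · have hA : HasSum (fun k => besselCoeff β k * (1 - s ^ 2) ^ (k + 2))
        (besselProfile β (1 - s ^ 2)) :=
      (summable_besselProfile β (by linarith) (by linarith)).hasSum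
    have hAB := Real.hasSum_mul_prod hA (Real.hasSum_cos (w * s))
    exact hAB

/-- Keeping `E` abstract treats `cosh` (`z ≥ 0`) and `cos` (`z ≤ 0`) at once. -/
lemma hasSum_even_series {E : ℝ → ℝ} {z : ℝ}
    (hE : ∀ s, HasSum (fun j : ℕ => (z * s ^ 2) ^ j / (2 * j).factorial) (E s)) :
    HasSum (fun j : ℕ => z ^ j / (2 * j).factorial * quadMoment 2 j)
      (∫ s in (-1 : ℝ)..1, (1 - s ^ 2) ^ 2 * E s) := by
  have hF (j : ℕ) : z ^ j / (2 * j).factorial * quadMoment 2 j =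
      ∫ s in (-1 : ℝ)..1, (1 - s ^ 2) ^ 2 * ((z * s ^ 2) ^ j / (2 * j).factorial) := by
    rw [quadMoment, ← intervalIntegral.integral_const_mul]
    refine intervalIntegral.integral_congr fun s _ => ?_
    simp only [mul_pow, pow_mul]
    ring
  simp only [hF]
  have hC : Summable fun j : ℕ => |z| ^ j / (2 * j).factorial := by
    have := (hE 1).summable.abs
    refine this.congr fun j => ?_
    rw [abs_div, abs_pow, Nat.abs_cast, one_pow, mul_one]
  refine Real.hasSum_integral_of_abs_le (by norm_num) (fun j => by fun_prop)
    (fun j s h1 h2 => ?_) hC (fun s h1 h2 => (hE s).mul_left _)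
  have hs2 : s ^ 2 ≤ 1 := by nlinarith
  have hs0 := sq_nonneg s
  have h3 : (1 - s ^ 2) ^ 2 ≤ 1 := pow_le_one₀ (by linarith) (by linarith)
  rw [abs_mul, abs_of_nonneg (by positivity), abs_div, abs_pow, abs_mul, abs_of_nonneg hs0,
    Nat.abs_cast]
  refine (mul_le_of_le_one_left (by positivity) h3).trans ?_
  gcongr
  exact mul_le_of_le_one_right (abs_nonneg _) hs2

/-- The finite-interval cosine transform of the Bessel profile in Poisson-integral form. -/
lemma integral_besselProfile_mul_cos {β w : ℝ} {E : ℝ → ℝ}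
    (hE : ∀ s, HasSum (fun j : ℕ => ((β ^ 2 - w ^ 2) * s ^ 2) ^ j / (2 * j).factorial) (E s)) :
    ∫ s in (-1 : ℝ)..1, besselProfile β (1 - s ^ 2) * Real.cos (w * s) =
      β ^ 2 / 8 * ∫ s in (-1 : ℝ)..1, (1 - s ^ 2) ^ 2 * E s := by
  have h1 := hasSum_cos_integral β w
  rw [← Finset.HasAntidiagonal.sigmaAntidiagonalEquivProd.hasSum_iff] at h1
  have h2 := h1.sigma fun n => hasSum_fintype _
  have h3 := (hasSum_even_series hE).mul_left (β ^ 2 / 8)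
  have h4 (n : ℕ) : ∑ b : Finset.HasAntidiagonal.antidiagonal n, besselCoeff β b.1.1 * ((-1) ^ b.1.2 *
      w ^ (2 * b.1.2) / (2 * b.1.2).factorial) * quadMoment (b.1.1 + 2) b.1.2 =
      β ^ 2 / 8 * ((β ^ 2 - w ^ 2) ^ n / (2 * n).factorial * quadMoment 2 n) := by
    rw [Finset.sum_coe_sort
      (Finset.HasAntidiagonal.antidiagonal n) (fun p : ℕ × ℕ => besselCoeff β p.1 *
      ((-1) ^ p.2 * w ^ (2 * p.2) / (2 * p.2).factorial) * quadMoment (p.1 + 2) p.2)]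
    rw [sub_eq_add_neg, (Commute.all _ _).add_pow', Finset.sum_div, Finset.sum_mul, Finset.mul_sum]
    refine Finset.sum_congr rfl fun p hp => ?_
    obtain ⟨k, j⟩ := p
    obtain rfl : k + j = n := by simpa using hp
    simp only [nsmul_eq_mul]
    -- Both moments are multiples of the same `quadMoment (2 + k + j) 0`, so only factorials remain
    -- to be compared. The `8` is `4 · 2!`: `4` from `(β/2)²`, `2!` from the weight `(1 - s²)²`.
    rw [quadMoment_eq (k + 2), quadMoment_eq 2, Nat.cast_add_choose, besselCoeff, neg_pow (w ^ 2),
      show k + 2 + j = 2 + (k + j) by ring, show β ^ (2 : ℕ) = 4 * (β / 2) ^ 2 by ring, mul_pow,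
      pow_add (4 : ℝ), pow_mul w, pow_add _ (2 * k), pow_mul (β / 2)]
    have e1 : ((k + j).factorial : ℝ) ≠ 0 := by positivity
    have e2 : ((2 * (k + j)).factorial : ℝ) ≠ 0 := by positivity
    have e3 : ((2 * j).factorial : ℝ) ≠ 0 := by positivity
    have e4 : ((2 + (k + j)).factorial : ℝ) ≠ 0 := by positivity
    have e5 : ((k + 2).factorial : ℝ) ≠ 0 := by positivity
    rw [show (Nat.factorial 2 : ℝ) = 2 by norm_num]
    field_simp
    ring
  simp only [← h4] at h3
  exact h2.unique h3

/-! ### Evaluation and bounds for the elementary integrals -/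

lemma integral_quad_mul_cosh {x : ℝ} (hx : x ≠ 0) :
    ∫ s in (-1 : ℝ)..1, (1 - s ^ 2) ^ 2 * Real.cosh (x * s) =
      16 * ((x ^ 2 + 3) * Real.sinh x - 3 * x * Real.cosh x) / x ^ 5 := by
  rw [intervalIntegral.integral_eq_sub_of_hasDerivAt
    (f := fun s => ((1 - s ^ 2) ^ 2 / x + (12 * s ^ 2 - 4) / x ^ 3 + 24 / x ^ 5) *
      Real.sinh (x * s) + (4 * s * (1 - s ^ 2) / x ^ 2 - 24 * s / x ^ 4) * Real.cosh (x * s))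
    (fun s _ => ?_) (Continuous.intervalIntegrable (by fun_prop) _ _)]
  · simp only [mul_neg, mul_one, Real.sinh_neg, Real.cosh_neg]
    field_simp
    ring
  · have hl : HasDerivAt (fun s : ℝ => x * s) x s := by
      simpa using (hasDerivAt_id s).const_mul x
    have h2 : HasDerivAt (fun s : ℝ => 1 - s ^ 2) (-(2 * s)) s := by
      simpa using (hasDerivAt_pow 2 s).const_sub 1
    have hp : HasDerivAt (fun s : ℝ => (1 - s ^ 2) ^ 2 / x + (12 * s ^ 2 - 4) / x ^ 3 + 24 / x ^ 5)
        (-(4 * s * (1 - s ^ 2)) / x + 24 * s / x ^ 3) s := by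
      refine ((((h2.fun_pow 2).div_const x).add
        ((((hasDerivAt_pow 2 s).const_mul 12).sub_const 4).div_const (x ^ 3))).add_const
        (24 / x ^ 5)).congr_deriv ?_
      simp
      ring
    have hq : HasDerivAt (fun s : ℝ => 4 * s * (1 - s ^ 2) / x ^ 2 - 24 * s / x ^ 4)
        ((4 - 12 * s ^ 2) / x ^ 2 - 24 / x ^ 4) s := by
      refine (((((hasDerivAt_id s).const_mul 4).mul h2).div_const (x ^ 2)).sub
        (((hasDerivAt_id s).const_mul 24).div_const (x ^ 4))).congr_deriv ?_
      simp
      ring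
    refine ((hp.mul hl.sinh).add (hq.mul hl.cosh)).congr_deriv ?_
    field_simp
    ring

lemma integral_quad_mul_cos {x : ℝ} (hx : x ≠ 0) :
    ∫ s in (-1 : ℝ)..1, (1 - s ^ 2) ^ 2 * Real.cos (x * s) =
      16 * ((3 - x ^ 2) * Real.sin x - 3 * x * Real.cos x) / x ^ 5 := by
  rw [intervalIntegral.integral_eq_sub_of_hasDerivAt
    (f := fun s => ((1 - s ^ 2) ^ 2 / x - (12 * s ^ 2 - 4) / x ^ 3 + 24 / x ^ 5) *
      Real.sin (x * s) + (-(4 * s * (1 - s ^ 2) / x ^ 2) - 24 * s / x ^ 4) * Real.cos (x * s))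
    (fun s _ => ?_) (Continuous.intervalIntegrable (by fun_prop) _ _)]
  · simp only [mul_neg, mul_one, Real.sin_neg, Real.cos_neg]
    field_simp
    ring
  · have hl : HasDerivAt (fun s : ℝ => x * s) x s := by
      simpa using (hasDerivAt_id s).const_mul x
    have h2 : HasDerivAt (fun s : ℝ => 1 - s ^ 2) (-(2 * s)) s := by
      simpa using (hasDerivAt_pow 2 s).const_sub 1
    have hp : HasDerivAt (fun s : ℝ => (1 - s ^ 2) ^ 2 / x - (12 * s ^ 2 - 4) / x ^ 3 + 24 / x ^ 5)
        (-(4 * s * (1 - s ^ 2)) / x - 24 * s / x ^ 3) s := by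
      refine ((((h2.fun_pow 2).div_const x).sub
        ((((hasDerivAt_pow 2 s).const_mul 12).sub_const 4).div_const (x ^ 3))).add_const
        (24 / x ^ 5)).congr_deriv ?_
      simp
      ring
    have hq : HasDerivAt (fun s : ℝ => -(4 * s * (1 - s ^ 2) / x ^ 2) - 24 * s / x ^ 4)
        (-((4 - 12 * s ^ 2) / x ^ 2) - 24 / x ^ 4) s := by
      refine (((((hasDerivAt_id s).const_mul 4).mul h2).div_const (x ^ 2)).neg.sub
        (((hasDerivAt_id s).const_mul 24).div_const (x ^ 4))).congr_deriv ?_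
      simp
      ring
    refine ((hp.mul hl.sin).add (hq.mul hl.cos)).congr_deriv ?_
    field_simp
    ring

lemma integral_quad : ∫ s in (-1 : ℝ)..1, (1 - s ^ 2) ^ 2 = 16 / 15 := by
  rw [intervalIntegral.integral_eq_sub_of_hasDerivAt
    (f := fun s : ℝ => s - 2 / 3 * s ^ 3 + s ^ 5 / 5)
    (fun s _ => ?_) (Continuous.intervalIntegrable (by fun_prop) _ _)]
  · norm_num
  · refine (((hasDerivAt_id s).sub ((hasDerivAt_pow 3 s).const_mul (2 / 3))).add
      ((hasDerivAt_pow 5 s).div_const 5)).congr_deriv ?_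
    simp
    ring

lemma integral_quad_mul_cosh_mono {x y : ℝ} (hx : 0 ≤ x) (hxy : x ≤ y) :
    ∫ s in (-1 : ℝ)..1, (1 - s ^ 2) ^ 2 * Real.cosh (x * s) ≤
      ∫ s in (-1 : ℝ)..1, (1 - s ^ 2) ^ 2 * Real.cosh (y * s) := by
  refine intervalIntegral.integral_mono (by norm_num)
    (Continuous.intervalIntegrable (by fun_prop) _ _)
    (Continuous.intervalIntegrable (by fun_prop) _ _) fun s => ?_
  refine mul_le_mul_of_nonneg_left ?_ (by positivity)
  rw [Real.cosh_le_cosh, abs_mul, abs_mul, abs_of_nonneg hx, abs_of_nonneg (hx.trans hxy)]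
  gcongr

/-- The closed form behaves like `8e^x/x³`; half of it is given up to absorb lower-order terms. -/
lemma le_integral_quad_mul_cosh {x : ℝ} (hx : 5 ≤ x) :
    4 * Real.exp x / x ^ 3 ≤ ∫ s in (-1 : ℝ)..1, (1 - s ^ 2) ^ 2 * Real.cosh (x * s) := by
  have hx0 : 0 < x := by linarith
  rw [integral_quad_mul_cosh hx0.ne', Real.sinh_eq, Real.cosh_eq,
    div_le_div_iff₀ (by positivity) (by positivity)]
  have he : 1 + x + x ^ 2 / 2 ≤ Real.exp x := Real.quadratic_le_exp_of_nonneg hx0.le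
  have hn : Real.exp (-x) * Real.exp x = 1 := by rw [← Real.exp_add]; simp
  have hn0 : 0 < Real.exp (-x) := Real.exp_pos _
  have hmain : (x ^ 2 + 3 * x + 3) * Real.exp (-x) ≤ (x ^ 2 / 2 - 3 * x + 3) * Real.exp x := by
    have h1 : (x ^ 2 + 3 * x + 3) * Real.exp (-x) ≤ 3 := by
      have : (x ^ 2 + 3 * x + 3) ≤ 3 * Real.exp x := by nlinarith
      calc (x ^ 2 + 3 * x + 3) * Real.exp (-x) ≤ 3 * Real.exp x * Real.exp (-x) := by gcongr
        _ = 3 := by linarith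
    -- The larger root is `3 + √3 < 5`, and the value at `5` is exactly `1/2`.
    have h2 : 1 / 2 ≤ x ^ 2 / 2 - 3 * x + 3 := by nlinarith
    have h3 : 6 ≤ Real.exp x := by nlinarith
    nlinarith
  have : 4 * Real.exp x * x ^ 2 ≤ 16 * ((x ^ 2 + 3) * ((Real.exp x - Real.exp (-x)) / 2) -
      3 * x * ((Real.exp x + Real.exp (-x)) / 2)) := by nlinarith
  calc 4 * Real.exp x * x ^ 5 = 4 * Real.exp x * x ^ 2 * x ^ 3 := by ring
    _ ≤ _ := by gcongr

lemma abs_integral_quad_mul_cos_le (y : ℝ) :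
    |∫ s in (-1 : ℝ)..1, (1 - s ^ 2) ^ 2 * Real.cos (y * s)| ≤ 16 / 15 := by
  rw [← integral_quad]
  refine (intervalIntegral.abs_integral_le_integral_abs (by norm_num)).trans ?_
  refine intervalIntegral.integral_mono (by norm_num)
    (Continuous.intervalIntegrable (by fun_prop) _ _)
    (Continuous.intervalIntegrable (by fun_prop) _ _) fun s => ?_
  simp only
  rw [abs_mul, abs_of_nonneg (by positivity)]
  exact mul_le_of_le_one_right (by positivity) (Real.abs_cos_le_one _)

lemma abs_integral_quad_mul_cos_le_div {y : ℝ} (hy : 12 ≤ y) :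
    |∫ s in (-1 : ℝ)..1, (1 - s ^ 2) ^ 2 * Real.cos (y * s)| ≤ 20 / y ^ 3 := by
  have hy0 : 0 < y := by linarith
  rw [integral_quad_mul_cos hy0.ne', abs_div, abs_of_pos (pow_pos hy0 5), abs_mul,
    div_le_div_iff₀ (by positivity) (by positivity)]
  have h1 : |(3 - y ^ 2) * Real.sin y - 3 * y * Real.cos y| ≤ y ^ 2 + 3 * y := by
    refine (abs_sub _ _).trans (add_le_add ?_ ?_)
    · rw [abs_mul]
      have h3 : |3 - y ^ 2| ≤ y ^ 2 := by rw [abs_le]; constructor <;> nlinarith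
      exact (mul_le_of_le_one_right (abs_nonneg _) (Real.abs_sin_le_one _)).trans h3
    · rw [abs_mul, abs_of_pos (by positivity : 0 < 3 * y)]
      exact mul_le_of_le_one_right (by positivity) (Real.abs_cos_le_one _)
  -- Equivalent to `y ≥ 12`; the factor `5/4` turns `16` into `20`.
  have h2 : y ^ 2 + 3 * y ≤ 5 / 4 * y ^ 2 := by nlinarith
  calc |16| * |(3 - y ^ 2) * Real.sin y - 3 * y * Real.cos y| * y ^ 3
      ≤ 16 * (5 / 4 * y ^ 2) * y ^ 3 := by
        rw [abs_of_pos (by norm_num : (0 : ℝ) < 16)]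
        gcongr
        exact h1.trans h2
    _ = 20 * y ^ 5 := by ring

lemma integral_besselProfile_mul_cos_of_le {β w : ℝ} (h : w ^ 2 ≤ β ^ 2) :
    ∫ s in (-1 : ℝ)..1, besselProfile β (1 - s ^ 2) * Real.cos (w * s) =
      β ^ 2 / 8 * ∫ s in (-1 : ℝ)..1, (1 - s ^ 2) ^ 2 * Real.cosh (√(β ^ 2 - w ^ 2) * s) := by
  refine integral_besselProfile_mul_cos fun s => ?_
  have := Real.hasSum_cosh (√(β ^ 2 - w ^ 2) * s)
  simpa only [mul_pow, pow_mul, Real.sq_sqrt (sub_nonneg.2 h)] using this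

lemma integral_besselProfile_mul_cos_of_ge {β w : ℝ} (h : β ^ 2 ≤ w ^ 2) :
    ∫ s in (-1 : ℝ)..1, besselProfile β (1 - s ^ 2) * Real.cos (w * s) =
      β ^ 2 / 8 * ∫ s in (-1 : ℝ)..1, (1 - s ^ 2) ^ 2 * Real.cos (√(w ^ 2 - β ^ 2) * s) := by
  refine integral_besselProfile_mul_cos fun s => ?_
  have := Real.hasSum_cos (√(w ^ 2 - β ^ 2) * s)
  simp only [mul_pow, pow_mul, Real.sq_sqrt (sub_nonneg.2 h)] at this
  have hz (j : ℕ) : ((β ^ 2 - w ^ 2) * s ^ 2) ^ j / ((2 * j).factorial : ℝ) =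
      (-1) ^ j * ((w ^ 2 - β ^ 2) ^ j * (s ^ 2) ^ j) / ((2 * j).factorial : ℝ) := by
    rw [← mul_pow, ← mul_pow]
    ring_nf
  simpa only [hz] using this

lemma continuousOn_besselProfile (β : ℝ) : ContinuousOn (besselProfile β) (Set.Icc 0 1) := by
  refine continuousOn_tsum (fun k => by fun_prop) (summable_besselCoeff β) fun k u hu => ?_
  rw [Real.norm_eq_abs, abs_mul, abs_of_nonneg (besselCoeff_nonneg β k),
    abs_of_nonneg (pow_nonneg hu.1 _)]
  exact mul_le_of_le_one_right (besselCoeff_nonneg β k) (pow_le_one₀ hu.1 hu.2)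

/-! ### From the window to its Fourier transform -/

lemma integral_even_mul_exp {P : ℝ → ℝ} (hP : ContinuousOn P (Set.Icc (-1) 1))
    (heven : ∀ s, P (-s) = P s) (w : ℝ) :
    ∫ s in (-1 : ℝ)..1, Complex.exp (((-(w * s) : ℝ) : ℂ) * Complex.I) * (P s : ℂ) =
      ((∫ s in (-1 : ℝ)..1, P s * Real.cos (w * s) : ℝ) : ℂ) := by
  have hPc : ContinuousOn (fun s => (P s : ℂ)) (Set.uIcc (-1) 1) := by
    rw [Set.uIcc_of_le (by norm_num)]
    exact Complex.continuous_ofReal.comp_continuousOn hP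
  have hI (f : ℝ → ℂ) (hf : Continuous f) :
      IntervalIntegrable (fun s => f s * (P s : ℂ)) MeasureTheory.volume (-1) 1 :=
    (hf.continuousOn.mul hPc).intervalIntegrable
  have hneg : ∫ s in (-1 : ℝ)..1, Complex.exp (((w * s : ℝ) : ℂ) * Complex.I) * (P s : ℂ) =
      ∫ s in (-1 : ℝ)..1, Complex.exp (((-(w * s) : ℝ) : ℂ) * Complex.I) * (P s : ℂ) := by
    have := intervalIntegral.integral_comp_neg (a := -1) (b := 1)
      (fun s : ℝ => Complex.exp (((w * s : ℝ) : ℂ) * Complex.I) * (P s : ℂ))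
    simp only [neg_neg, heven, mul_neg] at this
    exact this.symm
  have hsum : (∫ s in (-1 : ℝ)..1, Complex.exp (((w * s : ℝ) : ℂ) * Complex.I) * (P s : ℂ)) +
      ∫ s in (-1 : ℝ)..1, Complex.exp (((-(w * s) : ℝ) : ℂ) * Complex.I) * (P s : ℂ) =
      2 * ((∫ s in (-1 : ℝ)..1, P s * Real.cos (w * s) : ℝ) : ℂ) := by
    rw [← intervalIntegral.integral_add (hI _ (by fun_prop)) (hI _ (by fun_prop)),
      ← intervalIntegral.integral_ofReal, ← intervalIntegral.integral_const_mul]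
    refine intervalIntegral.integral_congr fun s _ => ?_
    simp only [Complex.ofReal_mul, Complex.ofReal_cos, Complex.cos, Complex.ofReal_neg]
    ring
  rw [hneg] at hsum
  linear_combination hsum / 2

lemma windowFT_of_scaled {φ P : ℝ → ℝ} {L : ℝ} (hL : 0 < L)
    (hP : ContinuousOn P (Set.Icc (-1) 1)) (heven : ∀ s, P (-s) = P s)
    (hin : ∀ t ∈ Set.Icc (-L) L, φ t = P (t / L)) (hout : ∀ t ∉ Set.Icc (-L) L, φ t = 0) (v : ℝ) :
    windowFT φ v =
      ((L * ∫ s in (-1 : ℝ)..1, P s * Real.cos (2 * Real.pi * L * v * s) : ℝ) : ℂ) := by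
  have h1 : windowFT φ v = ∫ t in -L..L,
      Complex.exp (((-(2 * Real.pi * v * t) : ℝ) : ℂ) * Complex.I) * (P (t / L) : ℂ) := by
    rw [windowFT, Real.fourier_real_eq_integral_exp_smul,
      intervalIntegral.integral_of_le (by linarith), ← MeasureTheory.integral_Icc_eq_integral_Ioc,
      ← MeasureTheory.integral_indicator measurableSet_Icc]
    refine MeasureTheory.integral_congr_ae (Filter.Eventually.of_forall fun t => ?_)
    simp only [smul_eq_mul]
    by_cases ht : t ∈ Set.Icc (-L) L
    · rw [Set.indicator_of_mem ht, hin t ht]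
      congr 5
      ring
    · rw [Set.indicator_of_notMem ht, hout t ht]
      simp
  have h2 := intervalIntegral.integral_comp_mul_left (a := -1) (b := 1)
    (fun t : ℝ => Complex.exp (((-(2 * Real.pi * v * t) : ℝ) : ℂ) * Complex.I) * (P (t / L) : ℂ))
    hL.ne'
  rw [mul_neg, mul_one] at h2
  rw [h1, Complex.ofReal_mul, ← integral_even_mul_exp hP heven]
  have h3 : (L : ℂ) ≠ 0 := by exact_mod_cast hL.ne'
  rw [Complex.real_smul, Complex.ofReal_inv] at h2
  rw [← mul_inv_cancel_left₀ h3 (∫ t in -L..L, _), ← h2]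
  congr 1
  refine intervalIntegral.integral_congr fun s _ => ?_
  simp only [mul_div_cancel_left₀ s hL.ne']
  congr 5
  ring

lemma besselI_two_pos {β : ℝ} (hβ : 0 < β) : 0 < besselI 2 β := by
  rw [← besselProfile_one]
  exact besselProfile_pos hβ zero_lt_one le_rfl

lemma besselWindow_of_mem {m N₁ : ℕ} {β x : ℝ}
    (hx : x ∈ Set.Icc (-((m : ℝ) / N₁)) ((m : ℝ) / N₁)) :
    besselWindow m β N₁ x = 1 / besselI 2 β * besselProfile β (1 - (x / ((m : ℝ) / N₁)) ^ 2) := by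
  have h : (x / ((m : ℝ) / N₁)) ^ 2 = ((N₁ : ℝ) * x) ^ 2 / (m : ℝ) ^ 2 := by
    rw [← div_pow, div_div_eq_mul_div, mul_comm]
  have h1 : (x / ((m : ℝ) / N₁)) ^ 2 ≤ 1 := by
    rw [sq_le_one_iff_abs_le_one, abs_div]
    exact div_le_one_of_le₀ ((abs_le.2 hx).trans (le_abs_self _)) (abs_nonneg _)
  rw [besselWindow, if_pos hx, besselProfile_eq β (by linarith), h, mul_assoc]

lemma besselWindow_of_notMem {m N₁ : ℕ} {β x : ℝ}
    (hx : x ∉ Set.Icc (-((m : ℝ) / N₁)) ((m : ℝ) / N₁)) : besselWindow m β N₁ x = 0 := by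
  rw [besselWindow, if_neg hx]

/-- Since the profile vanishes at `0`, clamping its argument removes the case split; continuity and
monotonicity of the window follow from those of the profile. -/
lemma besselWindow_eq {m N₁ : ℕ} (hm : 0 < m) (hN₁ : 0 < N₁) (β x : ℝ) :
    besselWindow m β N₁ x =
      1 / besselI 2 β * besselProfile β (max 0 (1 - (x / ((m : ℝ) / N₁)) ^ 2)) := by
  have hL : (0 : ℝ) < (m : ℝ) / N₁ := by positivity
  have hiff : x ∈ Set.Icc (-((m : ℝ) / N₁)) ((m : ℝ) / N₁) ↔ (x / ((m : ℝ) / N₁)) ^ 2 ≤ 1 := by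
    rw [sq_le_one_iff_abs_le_one, abs_div, abs_of_pos hL, div_le_one hL, abs_le, Set.mem_Icc]
  by_cases hx : x ∈ Set.Icc (-((m : ℝ) / N₁)) ((m : ℝ) / N₁)
  · rw [besselWindow_of_mem hx, max_eq_right (by linarith [hiff.1 hx])]
  · rw [besselWindow_of_notMem hx, max_eq_left (by linarith [not_le.1 (mt hiff.2 hx)]),
      besselProfile_zero, mul_zero]

/-- The cosine transform of the rescaled Bessel profile. -/
noncomputable def besselCosTransform (β w : ℝ) : ℝ :=
  ∫ s in (-1 : ℝ)..1, besselProfile β (1 - s ^ 2) * Real.cos (w * s)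

lemma windowFT_besselWindow {m N₁ : ℕ} (hm : 0 < m) (hN₁ : 0 < N₁) (β v : ℝ) :
    windowFT (besselWindow m β N₁) v =
      (((m : ℝ) / N₁ * (1 / besselI 2 β) *
        besselCosTransform β (2 * Real.pi * ((m : ℝ) / N₁) * v) : ℝ) : ℂ) := by
  have hL : (0 : ℝ) < (m : ℝ) / N₁ := by positivity
  rw [windowFT_of_scaled (P := fun s => 1 / besselI 2 β * besselProfile β (1 - s ^ 2)) hL
    ?_ (by simp) (fun t ht => besselWindow_of_mem ht) (fun t ht => besselWindow_of_notMem ht)]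
  · simp only [mul_assoc (1 / besselI 2 β)]
    rw [besselCosTransform, intervalIntegral.integral_const_mul, mul_assoc ((m : ℝ) / N₁)]
  · refine continuousOn_const.mul ((continuousOn_besselProfile β).comp (by fun_prop) ?_)
    intro s hs
    have : s ^ 2 ≤ 1 := by nlinarith [hs.1, hs.2]
    exact ⟨by linarith, by linarith [sq_nonneg s]⟩

lemma le_besselCosTransform {β w x₀ : ℝ} (hx₀ : 5 ≤ x₀) (h : w ^ 2 + x₀ ^ 2 ≤ β ^ 2) :
    β ^ 2 / 8 * (4 * Real.exp x₀ / x₀ ^ 3) ≤ besselCosTransform β w := by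
  rw [besselCosTransform, integral_besselProfile_mul_cos_of_le (by nlinarith)]
  refine mul_le_mul_of_nonneg_left ?_ (by positivity)
  refine (le_integral_quad_mul_cosh hx₀).trans (integral_quad_mul_cosh_mono (by linarith) ?_)
  exact Real.le_sqrt_of_sq_le (by linarith)

lemma abs_besselCosTransform_le {β w : ℝ} (h : β ^ 2 ≤ w ^ 2) :
    |besselCosTransform β w| ≤ β ^ 2 / 8 * (16 / 15) := by
  rw [besselCosTransform, integral_besselProfile_mul_cos_of_ge h, abs_mul,
    abs_of_nonneg (by positivity : 0 ≤ β ^ 2 / 8)]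
  exact mul_le_mul_of_nonneg_left (abs_integral_quad_mul_cos_le _) (by positivity)

lemma abs_besselCosTransform_le_div {β w y : ℝ} (hy : 12 ≤ y) (h : β ^ 2 + y ^ 2 ≤ w ^ 2) :
    |besselCosTransform β w| ≤ β ^ 2 / 8 * (20 / y ^ 3) := by
  rw [besselCosTransform, integral_besselProfile_mul_cos_of_ge (by nlinarith), abs_mul,
    abs_of_nonneg (by positivity : 0 ≤ β ^ 2 / 8)]
  refine mul_le_mul_of_nonneg_left ?_ (by positivity)
  have h1 : y ≤ √(w ^ 2 - β ^ 2) := Real.le_sqrt_of_sq_le (by linarith)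
  refine (abs_integral_quad_mul_cos_le_div (hy.trans h1)).trans ?_
  gcongr

/-! ### Parameters, aliasing estimates and the window properties -/

section Parameters

variable {m : ℕ} {σ : ℝ}

lemma shapeParam_pos (hm : 2 ≤ m) (hσ : σ ∈ Set.Icc (5 / 4 : ℝ) 2) : 0 < shapeParam m σ := by
  have h1 := hσ.1
  have : 1 / (2 * σ) < 1 := by rw [div_lt_one (by linarith)]; linarith
  have hm0 : (0 : ℝ) < m := by positivity
  exact mul_pos (by positivity) (by linarith)

lemma five_le_rate (hm : 2 ≤ m) (hσ : σ ∈ Set.Icc (5 / 4 : ℝ) 2) :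
    5 ≤ 2 * Real.pi * m * √(1 - 1 / σ) := by
  have h1 := hσ.1
  have h2 : 1 / σ ≤ 4 / 5 := by
    rw [div_le_div_iff₀ (by linarith) (by norm_num)]
    linarith
  have h3 : 0.44 ≤ √(1 - 1 / σ) := Real.le_sqrt_of_sq_le (by linarith)
  have h4 : (2 : ℝ) ≤ m := by exact_mod_cast hm
  have h5 := Real.pi_gt_d2
  have h6 : 12.5 ≤ 2 * Real.pi * m := by nlinarith
  nlinarith

/-- With `a = 1/(2σ)`, this is `(1 - a)² - a² = 1 - 2a = 1 - 1/σ`, the source of the exponential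
rate. -/
lemma freq_sq_add_rate_sq_le (hσ : σ ∈ Set.Icc (5 / 4 : ℝ) 2) {ν : ℝ}
    (hν : |ν| ≤ 1 / (2 * σ)) :
    (2 * Real.pi * m * ν) ^ 2 + (2 * Real.pi * m * √(1 - 1 / σ)) ^ 2 ≤ shapeParam m σ ^ 2 := by
  have h1 := hσ.1
  have h2 : 1 / σ ≤ 1 := by rw [div_le_one (by linarith)]; linarith
  have h3 : ν ^ 2 ≤ (1 / (2 * σ)) ^ 2 := sq_le_sq' (abs_le.1 hν).1 (abs_le.1 hν).2
  have h4 : 1 / σ = 2 * (1 / (2 * σ)) := by field_simp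
  rw [shapeParam, mul_pow, mul_pow _ (√_), mul_pow _ (1 - _), Real.sq_sqrt (by linarith), ← mul_add]
  refine mul_le_mul_of_nonneg_left ?_ (by positivity)
  rw [h4]
  nlinarith

/-- With `a = 1/(2σ)`, `|ν + r| ≥ k + 1 - a` and `(k + 1 - a)² - (1 - a)² = k² + 2k(1 - a) ≥ k²`. -/
lemma shapeParam_sq_add_le (hσ : σ ∈ Set.Icc (5 / 4 : ℝ) 2) {ν : ℝ}
    (hν : |ν| ≤ 1 / (2 * σ)) {r : ℤ} {k : ℕ} (hr : r.natAbs = k + 1) :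
    shapeParam m σ ^ 2 + (2 * Real.pi * m * k) ^ 2 ≤ (2 * Real.pi * m * (ν + r)) ^ 2 := by
  have h1 := hσ.1
  have h2 : 1 / (2 * σ) ≤ 2 / 5 := by
    rw [div_le_div_iff₀ (by linarith) (by norm_num)]
    linarith
  have h3 : |(r : ℝ)| = k + 1 := by
    rw [← Int.cast_abs, Int.abs_eq_natAbs, hr]
    push_cast
    ring
  have h4 : k + 1 - 1 / (2 * σ) ≤ |ν + r| := by
    have := abs_sub_abs_le_abs_sub (r : ℝ) (-ν)
    rw [abs_neg, sub_neg_eq_add, h3, add_comm (r : ℝ)] at this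
    linarith
  have hk : (0 : ℝ) ≤ k := Nat.cast_nonneg k
  have h5 : (k + 1 - 1 / (2 * σ)) ^ 2 ≤ (ν + r) ^ 2 := by
    rw [← sq_abs (ν + r)]
    exact pow_le_pow_left₀ (by linarith) h4 2
  rw [shapeParam, mul_pow, mul_pow _ (k : ℝ), mul_pow _ (ν + r), ← mul_add]
  refine mul_le_mul_of_nonneg_left ?_ (by positivity)
  nlinarith

lemma rate_cube_le (hσ : σ ∈ Set.Icc (5 / 4 : ℝ) 2) :
    (2 * Real.pi * m * √(1 - 1 / σ)) ^ 3 ≤ 0.354 * (2 * Real.pi * m) ^ 3 := by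
  have h1 := hσ.1
  have h2 := hσ.2
  have h3 : 1 / σ ≤ 1 := by rw [div_le_one (by linarith)]; linarith
  have h4 : 1 / 2 ≤ 1 / σ := by gcongr
  -- `σ ≤ 2` gives `1 - 1/σ ≤ 1/2`, and `0.708` slightly exceeds `√(1/2)`; then `0.354 = 0.708 ·
  -- 1/2`.
  have h5 : √(1 - 1 / σ) ≤ 0.708 := by
    rw [Real.sqrt_le_left (by norm_num)]
    linarith
  have h6 : √(1 - 1 / σ) ^ 3 ≤ 0.354 := by
    rw [pow_succ, Real.sq_sqrt (by linarith)]
    nlinarith [Real.sqrt_nonneg (1 - 1 / σ)]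
  rw [mul_pow, mul_comm]
  gcongr

/-- A bound for the size of the aliasing term of index `±k`, relative to `e^{-2πm√(1-1/σ)}`. -/
noncomputable def aliasBound (m : ℕ) : ℕ → ℝ
  | 0 => 0
  | 1 => 25 * (m : ℝ) ^ 3
  | k + 2 => 2 / ((k : ℝ) + 1) ^ 2

lemma hasSum_aliasBound (m : ℕ) :
    HasSum (fun r : {r : ℤ // r ≠ 0} => aliasBound m (r : ℤ).natAbs)
      (2 * (25 * (m : ℝ) ^ 3 + Real.pi ^ 2 / 3)) := by
  have h1 : HasSum (fun k : ℕ => 2 / ((k : ℝ) + 1) ^ 2) (Real.pi ^ 2 / 3) := by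
    have h := ((hasSum_nat_add_iff' 1).2 hasSum_zeta_two).mul_left 2
    norm_num at h
    rw [show Real.pi ^ 2 / 3 = 2 * (Real.pi ^ 2 / 6) by ring]
    simpa only [div_eq_mul_inv] using h
  have h2 : HasSum (aliasBound m) (25 * (m : ℝ) ^ 3 + Real.pi ^ 2 / 3) := by
    have h := (hasSum_nat_add_iff (f := aliasBound m) 2).1 h1
    simpa [Finset.sum_range_succ, aliasBound, add_comm] using h
  have h3 : HasSum (fun r : ℤ => aliasBound m r.natAbs)
      (2 * (25 * (m : ℝ) ^ 3 + Real.pi ^ 2 / 3)) := by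
    -- Index `0` occurs in both halves; the value `aliasBound m 0 = 0` makes the correction vanish.
    have h := HasSum.of_nat_of_neg (f := fun r : ℤ => aliasBound m r.natAbs)
      (by simpa using h2) (by simpa using h2)
    simpa [aliasBound, two_mul] using h
  refine (hasSum_subtype_iff_of_support_subset (s := {r : ℤ | r ≠ 0}) fun r hr => ?_).2 h3
  rintro rfl
  exact hr (by simp [aliasBound])

lemma IsAdmissible.abs_div_le {N N₁ : ℕ} (hN : IsAdmissible σ N N₁) {v : ℝ}
    (hv : v ∈ Set.Icc (-((N : ℝ) / 2)) ((N : ℝ) / 2)) : |v / N₁| ≤ 1 / (2 * σ) := by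
  obtain ⟨hN0, -, hN₁, -, h⟩ := hN
  have hN0' : (0 : ℝ) < N := by exact_mod_cast hN0
  have hN₁' : (0 : ℝ) < N₁ := by exact_mod_cast hN₁
  have hσ : 0 < σ := by
    rw [h] at hN₁'
    exact pos_of_mul_pos_left hN₁' hN0'.le
  rw [abs_div, abs_of_pos hN₁', div_le_div_iff₀ hN₁' (by positivity), h]
  nlinarith [abs_le.2 hv]

lemma mem_Icc_of_mem_freqIndex {N : ℕ} (hN : Even N) {n : ℤ} (hn : n ∈ freqIndex N) :
    (n : ℝ) ∈ Set.Icc (-((N : ℝ) / 2)) ((N : ℝ) / 2) := by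
  -- Evenness makes the integer division in `freqIndex` exact.
  obtain ⟨k, rfl⟩ := hN
  rw [freqIndex, Finset.mem_Ico] at hn
  have h1 : -(k : ℤ) ≤ n := by omega
  have h2 : n ≤ (k : ℤ) := by omega
  have h1' : -(k : ℝ) ≤ n := by exact_mod_cast h1
  have h2' : (n : ℝ) ≤ k := by exact_mod_cast h2
  push_cast
  constructor <;> linarith

lemma le_besselCosTransform_of_abs_le (hm : 2 ≤ m) (hσ : σ ∈ Set.Icc (5 / 4 : ℝ) 2) {ν : ℝ}
    (hν : |ν| ≤ 1 / (2 * σ)) :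
    shapeParam m σ ^ 2 / 8 * (4 * Real.exp (2 * Real.pi * m * √(1 - 1 / σ)) /
      (2 * Real.pi * m * √(1 - 1 / σ)) ^ 3) ≤
      besselCosTransform (shapeParam m σ) (2 * Real.pi * m * ν) :=
  le_besselCosTransform (five_le_rate hm hσ) (freq_sq_add_rate_sq_le hσ hν)

lemma besselCosTransform_pos (hm : 2 ≤ m) (hσ : σ ∈ Set.Icc (5 / 4 : ℝ) 2) {ν : ℝ}
    (hν : |ν| ≤ 1 / (2 * σ)) :
    0 < besselCosTransform (shapeParam m σ) (2 * Real.pi * m * ν) := by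
  have h1 := five_le_rate hm hσ
  have h2 := shapeParam_pos hm hσ
  exact lt_of_lt_of_le (by positivity) (le_besselCosTransform_of_abs_le hm hσ hν)

lemma isWindow_besselWindow (hm : 2 ≤ m) (hσ : σ ∈ Set.Icc (5 / 4 : ℝ) 2) {N N₁ : ℕ}
    (hN : IsAdmissible σ N N₁) : IsWindow m N N₁ (besselWindow m (shapeParam m σ) N₁) := by
  have hβ := shapeParam_pos hm hσ
  have hI := besselI_two_pos hβ
  have hm0 : 0 < m := by omega
  have hN₁ : 0 < N₁ := hN.2.2.1
  have hL : (0 : ℝ) < (m : ℝ) / N₁ := by positivity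
  set β := shapeParam m σ with hβdef
  set L : ℝ := (m : ℝ) / N₁ with hLdef
  have heq (x : ℝ) := besselWindow_eq hm0 hN₁ β x
  rw [← hLdef] at heq
  have hu0 (x : ℝ) : 0 ≤ max 0 (1 - (x / L) ^ 2) := le_max_left _ _
  have hu1 (x : ℝ) : max 0 (1 - (x / L) ^ 2) ≤ 1 :=
    max_le zero_le_one (by linarith [sq_nonneg (x / L)])
  have hnonneg {u : ℝ} (h0 : 0 ≤ u) (h1 : u ≤ 1) : 0 ≤ besselProfile β u := by
    simpa [besselProfile_zero] using besselProfile_mono β le_rfl h0 h1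
  refine ⟨fun x => ?_, fun x => ?_, ?_, ?_, ?_, ?_, ?_, ?_⟩
  · rw [heq]
    refine ⟨mul_nonneg (by positivity) (hnonneg (hu0 x) (hu1 x)), ?_⟩
    rw [one_div_mul_eq_div, div_le_one hI, ← besselProfile_one]
    exact besselProfile_mono β (hu0 x) (hu1 x) le_rfl
  · rw [heq, heq, neg_div, neg_sq]
  · have hsupp : Function.support (besselWindow m β N₁) = Set.Ioo (-L) L := by
      ext x
      rw [Function.mem_support, heq, Set.mem_Ioo, ← abs_lt]
      have hiff : |x| < L ↔ (x / L) ^ 2 < 1 := by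
        rw [sq_lt_one_iff_abs_lt_one, abs_div, abs_of_pos hL, div_lt_one hL]
      rw [hiff]
      constructor
      · intro h
        by_contra h1
        exact h (by rw [max_eq_left (by linarith), besselProfile_zero, mul_zero])
      · intro h
        have := besselProfile_pos hβ (lt_of_lt_of_le (by linarith) (le_max_right 0 _)) (hu1 x)
        positivity
    rw [tsupport, hsupp, closure_Ioo (by linarith)]
  · rw [funext heq]
    exact continuous_const.mul ((continuousOn_besselProfile β).comp_continuous (by fun_prop)
      fun x => ⟨hu0 x, hu1 x⟩)
  · intro x hx y hy hxy
    rw [heq, heq]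
    refine mul_le_mul_of_nonneg_left (besselProfile_mono β (hu0 y) ?_ (hu1 x)) (by positivity)
    have hx0 := hx.1
    have : (x / L) ^ 2 ≤ (y / L) ^ 2 := by gcongr
    exact max_le_max le_rfl (by linarith)
  · rw [heq]
    simp [besselProfile_one, hI.ne']
  · rw [heq, div_self hL.ne']
    simp [besselProfile_zero]
  · intro v hv
    rw [windowFT_besselWindow hm0 hN₁]
    refine ⟨?_, Complex.ofReal_im _⟩
    rw [Complex.ofReal_re]
    have h := besselCosTransform_pos hm hσ (hN.abs_div_le hv)
    rw [show 2 * Real.pi * ((m : ℝ) / N₁) * v = 2 * Real.pi * m * (v / N₁) by ring]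
    positivity

lemma abs_besselCosTransform_div_le (hm : 2 ≤ m) (hσ : σ ∈ Set.Icc (5 / 4 : ℝ) 2) {ν : ℝ}
    (hν : |ν| ≤ 1 / (2 * σ)) {r : ℤ} (hr : r ≠ 0) :
    |besselCosTransform (shapeParam m σ) (2 * Real.pi * m * (ν + r))| /
      besselCosTransform (shapeParam m σ) (2 * Real.pi * m * ν) ≤
      aliasBound m r.natAbs * Real.exp (-(2 * Real.pi * m * √(1 - 1 / σ))) := by
  have hx := five_le_rate hm hσ
  have hβ := shapeParam_pos hm hσ
  have hlow := le_besselCosTransform_of_abs_le hm hσ hν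
  have hcube := rate_cube_le (m := m) hσ
  have hm2 : (2 : ℝ) ≤ m := by exact_mod_cast hm
  have hpi := Real.pi_gt_d2
  have hX : 12 ≤ 2 * Real.pi * m := by nlinarith
  set x₀ := 2 * Real.pi * m * √(1 - 1 / σ)
  set β := shapeParam m σ
  have hpos : 0 < β ^ 2 / 8 * (4 * Real.exp x₀ / x₀ ^ 3) := by positivity
  -- The common `β²/8` cancels; an upper bound `c` for the numerator leaves `c x₀³/4 · e^{-x₀}`, and
  -- `rate_cube_le` replaces `x₀³`.
  have key {c b : ℝ} (hc : |besselCosTransform β (2 * Real.pi * m * (ν + r))| ≤ β ^ 2 / 8 * c)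
      (hc0 : 0 ≤ c) (hb : c * (0.354 * (2 * Real.pi * m) ^ 3) ≤ 4 * b) :
      |besselCosTransform β (2 * Real.pi * m * (ν + r))| /
        besselCosTransform β (2 * Real.pi * m * ν) ≤ b * Real.exp (-x₀) := by
    calc _ ≤ β ^ 2 / 8 * c / (β ^ 2 / 8 * (4 * Real.exp x₀ / x₀ ^ 3)) := by gcongr
      _ = c * x₀ ^ 3 / 4 * Real.exp (-x₀) := by
        rw [Real.exp_neg]
        field_simp
      _ ≤ b * Real.exp (-x₀) := by
        gcongr
        have := mul_le_mul_of_nonneg_left hcube hc0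
        linarith
  obtain ⟨k, hk⟩ : ∃ k, r.natAbs = k + 1 := Nat.exists_eq_succ_of_ne_zero (by simpa using hr)
  have hfreq := shapeParam_sq_add_le (m := m) hσ hν hk
  rw [hk]
  rcases k with _ | k
  -- For `|r| = 1`, the constant is `(16/15) · 0.354 · 8π³/4 < 25`.
  · refine key (abs_besselCosTransform_le (by simpa using hfreq)) (by norm_num) ?_
    have h3 : Real.pi ^ 3 ≤ 31.1 :=
      (pow_le_pow_left₀ Real.pi_pos.le Real.pi_lt_d4.le 3).trans (by norm_num)
    have hm3 : (0 : ℝ) ≤ (m : ℝ) ^ 3 := by positivity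
    simp only [aliasBound]
    nlinarith
  · have hk1 : (1 : ℝ) ≤ (k : ℝ) + 1 := by linarith [(Nat.cast_nonneg k : (0 : ℝ) ≤ k)]
    push_cast at hfreq
    -- The powers of `2πm` cancel, so these terms are free of `m`; one power of `k + 1` is dropped
    -- to sum by `ζ(2)`.
    refine key (abs_besselCosTransform_le_div (y := 2 * Real.pi * m * (k + 1))
      (by nlinarith) hfreq) (by positivity) ?_
    simp only [aliasBound]
    have h4 : ((k : ℝ) + 1) ^ 2 ≤ ((k : ℝ) + 1) ^ 3 := pow_le_pow_right₀ hk1 (by norm_num)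
    calc 20 / (2 * Real.pi * m * ((k : ℝ) + 1)) ^ 3 * (0.354 * (2 * Real.pi * m) ^ 3)
        = 7.08 / ((k : ℝ) + 1) ^ 3 := by
          field_simp
          norm_num
      _ ≤ 8 / ((k : ℝ) + 1) ^ 2 := by gcongr; norm_num
      _ = _ := by ring

lemma norm_aliasTerm_le (hm : 2 ≤ m) (hσ : σ ∈ Set.Icc (5 / 4 : ℝ) 2) {N N₁ : ℕ}
    (hN : IsAdmissible σ N N₁) {n : ℤ} (hn : n ∈ freqIndex N) {r : ℤ} (hr : r ≠ 0) :
    ‖aliasTerm N₁ (besselWindow m (shapeParam m σ) N₁) n r‖ ≤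
      aliasBound m r.natAbs * Real.exp (-(2 * Real.pi * m * √(1 - 1 / σ))) := by
  have hν := hN.abs_div_le (mem_Icc_of_mem_freqIndex hN.2.1 hn)
  have hm0 : 0 < m := by omega
  have hN₁ : 0 < N₁ := hN.2.2.1
  have hN₁' : (N₁ : ℝ) ≠ 0 := by positivity
  have hI := besselI_two_pos (shapeParam_pos hm hσ)
  have hc : (m : ℝ) / N₁ * (1 / besselI 2 (shapeParam m σ)) ≠ 0 := by positivity
  refine le_trans (le_of_eq ?_) (abs_besselCosTransform_div_le hm hσ hν hr)
  rw [aliasTerm, norm_smul, fourier_norm, mul_one, windowFT_besselWindow hm0 hN₁,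
    windowFT_besselWindow hm0 hN₁, ← Complex.ofReal_div, Complex.norm_real, Real.norm_eq_abs,
    mul_div_mul_left _ _ hc, abs_div,
    show 2 * Real.pi * ((m : ℝ) / N₁) * n = 2 * Real.pi * m * (n / N₁) by ring,
    show 2 * Real.pi * ((m : ℝ) / N₁) * (n + r * N₁) = 2 * Real.pi * m * (n / N₁ + r) by
      field_simp,
    abs_of_pos (besselCosTransform_pos hm hσ hν)]

lemma errorConstAt_besselWindow_le (hm : 2 ≤ m) (hσ : σ ∈ Set.Icc (5 / 4 : ℝ) 2) {N N₁ : ℕ}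
    (hN : IsAdmissible σ N N₁) :
    errorConstAt N N₁ (besselWindow m (shapeParam m σ) N₁) ≤
      ENNReal.ofReal ((50 * (m : ℝ) ^ 3 + 7) *
        Real.exp (-(2 * Real.pi * m * √(1 - 1 / σ)))) := by
  refine iSup₂_le fun n hn => ?_
  rw [← ofReal_norm]
  refine ENNReal.ofReal_le_ofReal ?_
  refine (tsum_of_norm_bounded ((hasSum_aliasBound m).mul_right _)
    fun r => norm_aliasTerm_le hm hσ hN hn r.2).trans ?_
  have := Real.pi_lt_d2
  have := Real.pi_pos
  gcongr
  nlinarith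

end Parameters

theorem theorem5p4 (m : ℕ) (hm : 2 ≤ m) (σ : ℝ) (hσ : σ ∈ Set.Icc (5 / 4 : ℝ) 2)
    (N N₁ : ℕ) (hN : IsAdmissible σ N N₁) :
    IsWindow m N N₁ (besselWindow m (shapeParam m σ) N₁) ∧
    (∀ n ∈ freqIndex N, Summable fun r : {r : ℤ // r ≠ 0} =>
      aliasTerm N₁ (besselWindow m (shapeParam m σ) N₁) n (r : ℤ)) ∧
    errorConst σ (besselWindow m (shapeParam m σ)) ≤
      ENNReal.ofReal ((50 * (m : ℝ) ^ 3 + 7) *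
        Real.exp (-(2 * Real.pi * m * √(1 - 1 / σ)))) :=
  ⟨isWindow_besselWindow hm hσ hN,
    fun _ hn => Summable.of_norm_bounded ((hasSum_aliasBound m).summable.mul_right _)
      fun r => norm_aliasTerm_le hm hσ hN hn r.2,
    iSup_le fun _ => iSup_le fun _ => iSup_le fun h => errorConstAt_besselWindow_le hm hσ h⟩
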